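/- Let $\mathcal X$ be a complex Hilbert space and let $\mathcal P_0:\mathcal X\supset\operatorname{dom}\mathcal P_0\to\mathcal X$ and $\mathcal S_0:\mathcal X\supset\operatorname{dom}\mathcal S_0\to\mathcal X$ be densely defined linear operators with adjoints $\mathcal P:=\mathcal P_0^*$ and $\mathcal S:=\mathcal S_0^*$. Let $\left[\begin{smallmatrix}\mathcal P\\ \mathcal S\end{smallmatrix}\right]x=(\mathcal Px,\mathcal Sx)$ for $x\in\operatorname{dom}\left[\begin{smallmatrix}\mathcal P\\ \mathcal S\end{smallmatrix}\right]:=\operatorname{dom}\mathcal P\cap\operatorname{dom}\mathcal S$, and assume that this operator is coercive: there is $c>0$ with $$\left(\|\mathcal Px\|^2+\|\mathcal Sx\|^2\right)^{1/2}\ge c\|x\|\qquad\text{for all }x\in\operatorname{dom}\mathcal P\cap\operatorname{dom}\mathcal S .$$ Let $$H:=\{(f_1,f_2)\in\operatorname{dom}\mathcal S_0\times\operatorname{dom}\mathcal P_0 \mid \mathcal S_0f_1=\mathcal P_0f_2\}\subset\mathcal X\times\mathcal X ,$$ and let $H^*:=\{(g_1,g_2)\in\mathcal X\times\mathcal X\mid\langle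 g_2,h_1\rangle=\langle g_1,h_2\rangle\text{ for all }(h_1,h_2)\in H\}$ be its adjoint relation. Assume that $H$ is symmetric, i.e. $H\subset H^*$, and that $$H^*=\operatorname{ran}\left[\begin{smallmatrix}\mathcal P\\ \mathcal S\end{smallmatrix}\right].$$ A boundary triplet for $\operatorname{ran}\left[\begin{smallmatrix}\mathcal P\\ \mathcal S\end{smallmatrix}\right]$ is a triplet $(\mathcal G,\Gamma_0,\Gamma_1)$ consisting of a complex Hilbert space $\mathcal G$ and linear maps $\Gamma_0,\Gamma_1:\operatorname{dom}\mathcal P\cap\operatorname{dom}\mathcal S\to\mathcal G$ such that $x\mapsto(\Gamma_0x,\Gamma_1x)$ is surjective onto $\mathcal G\times\mathcal G$ and $$\langle\mathcal Sx,\mathcal Py\rangle_{\mathcal X}-\langle\mathcal Px,\mathcal Sy\rangle_{\mathcal X}=\langle\Gamma_1x,\Gamma_0y\rangle_{\mathcal G}-\langle\Gamma_0x,\Gamma_1y\rangle_{\mathcal G}\qquad\text{for all }x,y\in\operatorname{dom}\mathcal P\cap\operatorname{dom}\mathcal S .$$ Then a boundary triplet for $H^*=\operatorname{ran}\left[\begin{smallmatrix}\mathcal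 P\\ \mathcal S\end{smallmatrix}\right]$ exists if and only if $$\dim\ker(\mathcal S-i\mathcal P)=\dim\ker(\mathcal S+i\mathcal P),$$ where $\dim$ of a linear subspace of $\mathcal X$ denotes the Hilbert space dimension (the cardinality of an orthonormal basis) of its closure. -/

import Mathlib

open scoped LinearPMap

universe u

/-- The column operator `[P; S]` of two partially defined operators in a Hilbert space `X`:
its domain is `dom P ∩ dom S` and it maps `x` to `(P x, S x)`. -/
noncomputable def columnOp {X : Type u} [NormedAddCommGroup X] [InnerProductSpace ℂ X]
    (P S : X →ₗ.[ℂ] X) : X →ₗ.[ℂ] (X × X) where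
  domain := P.domain ⊓ S.domain
  toFun := (P.toFun.comp (Submodule.inclusion inf_le_left)).prod
    (S.toFun.comp (Submodule.inclusion inf_le_right))

/-- The linear relation `ran [P; S] = {(P x, S x) | x ∈ dom P ∩ dom S}` in `X`. -/
noncomputable def rangeRelation {X : Type u} [NormedAddCommGroup X] [InnerProductSpace ℂ X]
    (P S : X →ₗ.[ℂ] X) : Submodule ℂ (X × X) :=
  LinearMap.range (columnOp P S).toFun

/-- Coercivity of the column operator: for some `c > 0`, `‖[P; S] x‖ ≥ c ‖x‖` for all `x` in its
domain, where the product space carries its Hilbert space norm (hence `WithLp 2`). -/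
def ColumnCoercive {X : Type u} [NormedAddCommGroup X] [InnerProductSpace ℂ X]
    (P S : X →ₗ.[ℂ] X) : Prop :=
  ∃ c : ℝ, 0 < c ∧ ∀ x : (columnOp P S).domain,
    c * ‖(x : X)‖ ≤ ‖WithLp.toLp 2 (columnOp P S x)‖

/-- The linear relation `H = (gr P₀)⁻¹ (gr S₀)`, that is
`{(f₁, f₂) ∈ dom S₀ × dom P₀ | S₀ f₁ = P₀ f₂}`. -/
def kernelRelation {X : Type u} [NormedAddCommGroup X] [InnerProductSpace ℂ X]
    (P₀ S₀ : X →ₗ.[ℂ] X) : Submodule ℂ (X × X) where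
  carrier := {p | ∃ g : X, (p.1, g) ∈ S₀.graph ∧ (p.2, g) ∈ P₀.graph}
  zero_mem' := ⟨0, S₀.graph.zero_mem, P₀.graph.zero_mem⟩
  add_mem' := by
    rintro p q ⟨g, hg₁, hg₂⟩ ⟨k, hk₁, hk₂⟩
    exact ⟨g + k, S₀.graph.add_mem hg₁ hk₁, P₀.graph.add_mem hg₂ hk₂⟩
  smul_mem' := by
    rintro c p ⟨g, hg₁, hg₂⟩
    exact ⟨c • g, S₀.graph.smul_mem c hg₁, P₀.graph.smul_mem c hg₂⟩

/-- A linear relation `H` in `X` is symmetric if `H ⊆ H*`.  Here `Submodule.adjoint` is the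
adjoint relation `{(g₁, g₂) | ⟨g₂, h₁⟩ = ⟨g₁, h₂⟩ for all (h₁, h₂) ∈ H}`. -/
def IsSymmetricRelation {X : Type u} [NormedAddCommGroup X] [InnerProductSpace ℂ X]
    (H : Submodule ℂ (X × X)) : Prop :=
  H ≤ H.adjoint

/-- The kernel `{x ∈ dom T | T x = 0}` of a partially defined operator, as a subspace of `X`. -/
def kernelOp {X : Type u} [NormedAddCommGroup X] [InnerProductSpace ℂ X]
    (T : X →ₗ.[ℂ] X) : Submodule ℂ X :=
  (LinearMap.ker T.toFun).map T.domain.subtype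

/-- The Hilbert space dimension of a linear subspace `M` of a Hilbert space: the cardinality of an
orthonormal basis of the closure of `M` (all orthonormal bases have the same cardinality). -/
noncomputable def hilbertDim {X : Type u} [NormedAddCommGroup X] [InnerProductSpace ℂ X]
    [CompleteSpace X] (M : Submodule ℂ X) : Cardinal.{u} :=
  Cardinal.mk (exists_hilbertBasis ℂ M.topologicalClosure).choose

/-- A boundary triplet `(G, Γ₀, Γ₁)` for `ran [P; S]`: linear maps `Γ₀, Γ₁ : dom [P; S] → G` into a
Hilbert space `G` such that `x ↦ (Γ₀ x, Γ₁ x)` is onto `G × G` and the abstract Green identity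
holds. -/
structure RangeBoundaryTriplet {X : Type u} [NormedAddCommGroup X] [InnerProductSpace ℂ X]
    (P S : X →ₗ.[ℂ] X)
    (G : Type u) [NormedAddCommGroup G] [InnerProductSpace ℂ G] [CompleteSpace G] where
  Γ₀ : (columnOp P S).domain →ₗ[ℂ] G
  Γ₁ : (columnOp P S).domain →ₗ[ℂ] G
  surjective : Function.Surjective (Γ₀.prod Γ₁)
  green : ∀ x y : (columnOp P S).domain,
    inner ℂ (columnOp P S x).2 (columnOp P S y).1 - inner ℂ (columnOp P S x).1 (columnOp P S y).2
      = inner ℂ (Γ₁ x) (Γ₀ y) - inner ℂ (Γ₀ x) (Γ₁ y)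

/-! Write N(z) = {n | (n, z n) ∈ H*}. Von Neumann's decomposition splits H* into the closure of H,
{(n, i n) | n ∈ N(i)} and {(m, -i m) | m ∈ N(-i)}. In the coordinates (n, m) the form ⟨f₂, g₁⟩ -
⟨f₁, g₂⟩ is -2i(⟨n, n'⟩ - ⟨m, m'⟩) (`inner_sub_inner_eq_defectComponent`). The Cayley transform of a
boundary triplet brings the same form to the same shape on G × G. By definiteness on each factor,
two such diagonalizations have factors of equal dimension
(`HilbertBasis.mk_eq_of_indefinite_form_eq`), so dim N(i) = dim G = dim N(-i). Conversely, a unitary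
N(i) → N(-i) turns the coordinates (n, m) into the Cayley transform of a triplet with G = N(-i).

It remains to replace N(±i) by ker(S ∓ iP). Coercivity makes (Px, Sx) ↦ x well defined and bounded,
so it carries N(±i) continuously and bijectively onto the kernel, which may fail to be closed. An
injective bounded map with dense range preserves Hilbert dimension
(`hilbertDim_eq_mk_of_defectSubspace`). -/

/-! ### Comparison of Hilbert space dimensions -/

/-- An injective linear map with an everywhere defined formal adjoint does not decrease the Hilbert
space dimension. -/
theorem HilbertBasis.mk_le_of_formalAdjoint {ι κ E F : Type u}
    [NormedAddCommGroup E] [InnerProductSpace ℂ E] [NormedAddCommGroup F] [InnerProductSpace ℂ F]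
    (b : HilbertBasis ι ℂ E) (c : HilbertBasis κ ℂ F) (A : E →ₗ[ℂ] F) (B : F →ₗ[ℂ] E)
    (hAB : ∀ x y, inner ℂ (A x) y = inner ℂ x (B y)) (hA : Function.Injective A) :
    Cardinal.mk ι ≤ Cardinal.mk κ := by
  cases finite_or_infinite κ with
  | inl hκ =>
    have := Fintype.ofFinite κ
    have h := (b.orthonormal.linearIndependent.map' A
      (LinearMap.ker_eq_bot.mpr hA)).cardinal_le_rank
    exact h.trans c.toOrthonormalBasis.toBasis.mk_eq_rank''.ge
  | inr hκ =>
    -- If every coefficient of `A (b i)` vanished, injectivity of `A` would force `b i = 0`.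
    have hcover : (Set.univ : Set ι) ⊆ ⋃ k, {i | inner ℂ (b i) (B (c k)) ≠ 0} := by
      intro i _
      by_contra hi
      simp only [Set.mem_iUnion, Set.mem_ofPred_eq, not_exists, not_not] at hi
      have hzero : A (b i) = 0 := by
        apply c.repr.injective
        ext k
        rw [map_zero, c.repr_apply_apply, ← inner_conj_symm, hAB, hi k]
        simp
      have : b i = 0 := hA (hzero.trans (map_zero A).symm)
      exact b.orthonormal.ne_zero i this
    -- By Bessel's inequality each `B (c k)` has only countably many nonzero coefficients.
    have hcount : ∀ k, Cardinal.mk {i | inner ℂ (b i) (B (c k)) ≠ 0} ≤ Cardinal.aleph0 := by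
      intro k
      rw [Cardinal.le_aleph0_iff_set_countable]
      have := (b.orthonormal.inner_products_summable (B (c k))).countable_support
      refine this.mono fun i hi => ?_
      simpa using hi
    calc Cardinal.mk ι = Cardinal.mk (Set.univ : Set ι) := Cardinal.mk_univ.symm
      _ ≤ Cardinal.mk (⋃ k, {i | inner ℂ (b i) (B (c k)) ≠ 0}) := Cardinal.mk_le_mk_of_subset hcover
      _ ≤ Cardinal.mk κ * ⨆ k, Cardinal.mk {i | inner ℂ (b i) (B (c k)) ≠ 0} :=
        Cardinal.mk_iUnion_le _
      _ ≤ Cardinal.mk κ * Cardinal.aleph0 := by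
        gcongr
        exact ciSup_le' hcount
      _ = Cardinal.mk κ := Cardinal.mul_aleph0_eq (Cardinal.infinite_iff.mp hκ)

/-- Hilbert spaces joined by an injective continuous map with dense range have the same Hilbert
space dimension. -/
theorem HilbertBasis.mk_eq_of_injective_of_denseRange {ι κ E F : Type u}
    [NormedAddCommGroup E] [InnerProductSpace ℂ E] [CompleteSpace E]
    [NormedAddCommGroup F] [InnerProductSpace ℂ F] [CompleteSpace F]
    (b : HilbertBasis ι ℂ E) (c : HilbertBasis κ ℂ F) (T : E →L[ℂ] F)
    (hinj : Function.Injective T) (hdense : DenseRange T) :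
    Cardinal.mk ι = Cardinal.mk κ := by
  apply le_antisymm
  · exact b.mk_le_of_formalAdjoint c T.toLinearMap (ContinuousLinearMap.adjoint T).toLinearMap
      (fun x y => (ContinuousLinearMap.adjoint_inner_right T x y).symm) hinj
  · refine c.mk_le_of_formalAdjoint b (ContinuousLinearMap.adjoint T).toLinearMap T.toLinearMap
      (fun x y => ContinuousLinearMap.adjoint_inner_left T y x) ?_
    refine (injective_iff_map_eq_zero _).mpr fun y hy => ?_
    refine hdense.eq_zero_of_inner_left ℂ ?_
    intro x
    have hy' : ContinuousLinearMap.adjoint T y = 0 := hy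
    rw [← ContinuousLinearMap.adjoint_inner_left, hy', inner_zero_left]

/-- Hilbert spaces of the same Hilbert space dimension are isometrically isomorphic. -/
theorem HilbertBasis.nonempty_linearIsometryEquiv {ι κ E F : Type u}
    [NormedAddCommGroup E] [InnerProductSpace ℂ E]
    [NormedAddCommGroup F] [InnerProductSpace ℂ F] [CompleteSpace F]
    (b : HilbertBasis ι ℂ E) (c : HilbertBasis κ ℂ F) (h : Cardinal.mk ι = Cardinal.mk κ) :
    Nonempty (E ≃ₗᵢ[ℂ] F) := by
  obtain ⟨e⟩ := Cardinal.eq.mp h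
  have hspan : ⊤ ≤ (Submodule.span ℂ (Set.range (c ∘ e))).topologicalClosure := by
    rw [e.surjective.range_comp, c.dense_span]
  exact ⟨b.repr.trans (HilbertBasis.mk (c.orthonormal.comp e e.injective) hspan).repr.symm⟩

/-- Two surjections onto products of Hilbert spaces which pull back the indefinite forms
`⟨x₁, y₁⟩ - ⟨x₂, y₂⟩` to the same form have first factors of comparable dimension. -/
theorem HilbertBasis.mk_le_of_indefinite_form_eq {ι κ E F G K : Type u} {D : Type*}
    [AddCommGroup D] [Module ℂ D]
    [NormedAddCommGroup E] [InnerProductSpace ℂ E] [NormedAddCommGroup F] [InnerProductSpace ℂ F]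
    [NormedAddCommGroup G] [InnerProductSpace ℂ G] [NormedAddCommGroup K] [InnerProductSpace ℂ K]
    (b : HilbertBasis ι ℂ E) (c : HilbertBasis κ ℂ G)
    (Φ : D →ₗ[ℂ] E × F) (Ψ : D →ₗ[ℂ] G × K)
    (hΦ : Function.Surjective Φ) (hΨ : Function.Surjective Ψ)
    (hform : ∀ x y, inner ℂ (Φ x).1 (Φ y).1 - inner ℂ (Φ x).2 (Φ y).2 =
      inner ℂ (Ψ x).1 (Ψ y).1 - inner ℂ (Ψ x).2 (Ψ y).2) :
    Cardinal.mk ι ≤ Cardinal.mk κ := by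
  obtain ⟨s, hs⟩ := Φ.exists_rightInverse_of_surjective (LinearMap.range_eq_top.mpr hΦ)
  obtain ⟨t, ht⟩ := Ψ.exists_rightInverse_of_surjective (LinearMap.range_eq_top.mpr hΨ)
  have hs' : ∀ x, Φ (s x) = x := LinearMap.congr_fun hs
  have ht' : ∀ x, Ψ (t x) = x := LinearMap.congr_fun ht
  -- Lift (x, 0) through one surjection and read off the first component of the other. The zeros
  -- remove the second-factor terms from the form, so the two maps are formal adjoints. The sections
  -- are only algebraic, hence no boundedness is available.
  refine b.mk_le_of_formalAdjoint c
    (LinearMap.fst ℂ G K ∘ₗ Ψ ∘ₗ s ∘ₗ LinearMap.inl ℂ E F)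
    (LinearMap.fst ℂ E F ∘ₗ Φ ∘ₗ t ∘ₗ LinearMap.inl ℂ G K) (fun x y => ?_) ?_
  · have h := hform (s (x, 0)) (t (y, 0))
    simp only [hs', ht', inner_zero_left, inner_zero_right, sub_zero] at h
    simpa using h.symm
  · refine (injective_iff_map_eq_zero _).mpr fun x hx => ?_
    have hx' : (Ψ (s (x, 0))).1 = 0 := by simpa using hx
    -- If the image of x is zero, the form at this lift equals ‖x‖² ≥ 0 on one side and minus a
    -- square on the other.
    have h := hform (s (x, 0)) (s (x, 0))
    simp only [hs', hx', inner_self_eq_norm_sq_to_K, norm_zero] at h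
    have h' : ‖x‖ ^ 2 - (0 : ℝ) ^ 2 = (0 : ℝ) ^ 2 - ‖(Ψ (s (x, 0))).2‖ ^ 2 := by exact_mod_cast h
    have : ‖x‖ ^ 2 = 0 := by nlinarith [sq_nonneg ‖x‖, sq_nonneg ‖(Ψ (s (x, 0))).2‖]
    simpa using this

/-- Two surjections onto products of Hilbert spaces which pull back the indefinite forms
`⟨x₁, y₁⟩ - ⟨x₂, y₂⟩` to the same form have first factors of the same dimension. -/
theorem HilbertBasis.mk_eq_of_indefinite_form_eq {ι κ E F G K : Type u} {D : Type*}
    [AddCommGroup D] [Module ℂ D]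
    [NormedAddCommGroup E] [InnerProductSpace ℂ E] [NormedAddCommGroup F] [InnerProductSpace ℂ F]
    [NormedAddCommGroup G] [InnerProductSpace ℂ G] [NormedAddCommGroup K] [InnerProductSpace ℂ K]
    (b : HilbertBasis ι ℂ E) (c : HilbertBasis κ ℂ G)
    (Φ : D →ₗ[ℂ] E × F) (Ψ : D →ₗ[ℂ] G × K)
    (hΦ : Function.Surjective Φ) (hΨ : Function.Surjective Ψ)
    (hform : ∀ x y, inner ℂ (Φ x).1 (Φ y).1 - inner ℂ (Φ x).2 (Φ y).2 =
      inner ℂ (Ψ x).1 (Ψ y).1 - inner ℂ (Ψ x).2 (Ψ y).2) :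
    Cardinal.mk ι = Cardinal.mk κ :=
  le_antisymm (b.mk_le_of_indefinite_form_eq c Φ Ψ hΦ hΨ hform)
    (c.mk_le_of_indefinite_form_eq b Ψ Φ hΨ hΦ fun x y => (hform x y).symm)

/-! ### Defect subspaces and the von Neumann decomposition -/

/-- The defect subspace `{n | (n, z n) ∈ H*}` of a linear relation `H` at the point `z`. -/
noncomputable def defectSubspace {X : Type u} [NormedAddCommGroup X] [InnerProductSpace ℂ X]
    (H : Submodule ℂ (X × X)) (z : ℂ) : Submodule ℂ X :=
  H.adjoint.comap (LinearMap.id.prod (z • LinearMap.id))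

section
variable {X : Type u} [NormedAddCommGroup X] [InnerProductSpace ℂ X]
  (H : Submodule ℂ (X × X))

theorem mem_defectSubspace {H : Submodule ℂ (X × X)} {z : ℂ} {n : X} :
    n ∈ defectSubspace H z ↔ (n, z • n) ∈ H.adjoint := Iff.rfl

theorem Submodule.isClosed_adjoint : IsClosed (H.adjoint : Set (X × X)) := by
  rw [Submodule.adjoint, Submodule.map_coe, LinearEquiv.coe_coe, LinearEquiv.image_eq_preimage_symm]
  exact (Submodule.isClosed_orthogonal _).preimage (WithLp.prod_continuous_toLp _ _ _)

theorem isClosed_defectSubspace (z : ℂ) : IsClosed (defectSubspace H z : Set X) :=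
  H.isClosed_adjoint.preimage (by fun_prop : Continuous fun n : X => (n, z • n))

instance [CompleteSpace X] (z : ℂ) : CompleteSpace (defectSubspace H z) :=
  (isClosed_defectSubspace H z).completeSpace_coe

/-- The closure of `H` is orthogonal to `H*` for the symplectic form. -/
theorem inner_sub_inner_eq_zero_of_mem_closure {f g : X × X}
    (hf : f ∈ H.topologicalClosure) (hg : g ∈ H.adjoint) :
    inner ℂ f.2 g.1 - inner ℂ f.1 g.2 = 0 := by
  have hcl : IsClosed {f : X × X | inner ℂ f.2 g.1 - inner ℂ f.1 g.2 = 0} :=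
    isClosed_eq (by fun_prop) continuous_const
  exact closure_minimal (fun a ha => (H.mem_adjoint_iff g).mp hg a.1 a.2 ha) hcl hf

/-- The von Neumann decomposition of the adjoint of a symmetric linear relation. -/
theorem exists_vonNeumann_decomposition [CompleteSpace X] (hH : IsSymmetricRelation H)
    {f : X × X} (hf : f ∈ H.adjoint) :
    ∃ h ∈ H.topologicalClosure, ∃ n ∈ defectSubspace H Complex.I,
      ∃ m ∈ defectSubspace H (-Complex.I),
        f = h + (n, Complex.I • n) + (m, -Complex.I • m) := by
  let e := WithLp.prodContinuousLinearEquiv 2 ℂ X X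
  let K : Submodule ℂ (WithLp 2 (X × X)) := H.topologicalClosure.comap e.toLinearMap
  have hKcl : IsClosed (K : Set (WithLp 2 (X × X))) :=
    H.isClosed_topologicalClosure.preimage e.continuous
  have : CompleteSpace K := hKcl.completeSpace_coe
  obtain ⟨h, hh, s, hs, hfs⟩ := K.exists_add_mem_mem_orthogonal (e.symm f)
  have hhf : e h ∈ H.topologicalClosure := hh
  have hsum : f = e h + e s := by rw [← map_add, ← hfs, e.apply_symm_apply]
  have hsR : e s ∈ H.adjoint := by
    have : e s = f - e h := by rw [hsum]; abel
    rw [this]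
    exact H.adjoint.sub_mem hf (H.topologicalClosure_minimal hH H.isClosed_adjoint hhf)
  -- Orthogonality to H says exactly that the rotation J(s₁, s₂) = (s₂, -s₁) sends s into H*.
  have hJs : ((e s).2, -(e s).1) ∈ H.adjoint := by
    refine (H.mem_adjoint_iff _).mpr fun a b hab => ?_
    have hmem : e.symm (a, b) ∈ K := by
      change e (e.symm (a, b)) ∈ H.topologicalClosure
      rw [e.apply_symm_apply]
      exact H.le_topologicalClosure hab
    have := (K.mem_orthogonal s).mp hs _ hmem
    rw [WithLp.prod_inner_apply] at this
    rw [inner_neg_right, sub_neg_eq_add, add_comm]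
    exact this
  have hI : Complex.I * Complex.I = -1 := Complex.I_mul_I
  -- Since J² = -1, (1 ∓ iJ)/2 project onto the eigenspaces {(n, ±i n)} of J. The witnesses are the
  -- first coordinates of these projections of s.
  refine ⟨e h, hhf, (1 / 2 : ℂ) • ((e s).1 - Complex.I • (e s).2), ?_,
    (1 / 2 : ℂ) • ((e s).1 + Complex.I • (e s).2), ?_, ?_⟩
  · rw [mem_defectSubspace]
    convert H.adjoint.smul_mem (1 / 2 : ℂ)
      (H.adjoint.sub_mem hsR (H.adjoint.smul_mem Complex.I hJs)) using 1
    ext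
    · simp
    · simp only [Prod.smul_snd, Prod.snd_sub]
      match_scalars <;> first | ring1 | linear_combination (-1 / 2 : ℂ) * hI
  · rw [mem_defectSubspace]
    convert H.adjoint.smul_mem (1 / 2 : ℂ)
      (H.adjoint.add_mem hsR (H.adjoint.smul_mem Complex.I hJs)) using 1
    ext
    · simp
    · simp only [Prod.smul_snd, Prod.snd_add]
      match_scalars <;> first | ring1 | linear_combination (-1 / 2 : ℂ) * hI
  · rw [add_assoc, hsum]
    congr 1
    ext
    · simp only [Prod.fst_add]
      module
    · simp only [Prod.snd_add]
      match_scalars <;> first | ring1 | linear_combination (1 : ℂ) * hI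

/-- The component of an element of `X × X` in the defect subspace at `z`, for `z = ± i`. -/
noncomputable def defectComponent [CompleteSpace X] (z : ℂ) : X × X →ₗ[ℂ] defectSubspace H z :=
  (1 / 2 : ℂ) • (defectSubspace H z).orthogonalProjectionOnto.toLinearMap ∘ₗ
    (LinearMap.fst ℂ X X - z • LinearMap.snd ℂ X X)

theorem inner_defectComponent [CompleteSpace X] (z : ℂ) (n : defectSubspace H z) (f : X × X) :
    inner ℂ n (defectComponent H z f) =
      (1 / 2 : ℂ) * (inner ℂ (n : X) f.1 - z * inner ℂ (n : X) f.2) := by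
  simp [defectComponent]
end

section
variable {X : Type u} [NormedAddCommGroup X] [InnerProductSpace ℂ X] [CompleteSpace X]
  (H : Submodule ℂ (X × X))

/-- Pairing h with (n, z n) ∈ H* gives ⟨n, h₂⟩ = z̄⟨n, h₁⟩, so ⟨n, h₁ - z h₂⟩ = (1 - |z|²)⟨n, h₁⟩ =
0. With the next two lemmas, this identifies `defectComponent` on H* with the von Neumann
coordinates when H is symmetric. -/
theorem defectComponent_eq_zero_of_mem_closure {z : ℂ} (hz : ‖z‖ = 1) {h : X × X}
    (hh : h ∈ H.topologicalClosure) : defectComponent H z h = 0 := by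
  refine ext_inner_left ℂ fun n => ?_
  have hW := inner_sub_inner_eq_zero_of_mem_closure H hh (mem_defectSubspace.mp n.2)
  simp only [inner_smul_right] at hW
  have hconj := congrArg (starRingEnd ℂ) hW
  simp only [map_sub, map_mul, inner_conj_symm, map_zero] at hconj
  have hzz : z * (starRingEnd ℂ) z = 1 := by
    rw [Complex.mul_conj, Complex.normSq_eq_norm_sq, hz]; simp
  rw [inner_defectComponent, inner_zero_right]
  linear_combination (-1 / 2 * z) * hconj - 1 / 2 * inner ℂ (n : X) h.1 * hzz

theorem defectComponent_mk_smul {z w : ℂ} (hzw : z * w = -1) (n : defectSubspace H z) :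
    defectComponent H z ((n : X), w • (n : X)) = n := by
  refine ext_inner_left ℂ fun k => ?_
  rw [inner_defectComponent, inner_smul_right, Submodule.coe_inner]
  linear_combination (-1 / 2 * inner ℂ (k : X) (n : X)) * hzw

theorem defectComponent_mk_smul_eq_zero {z w : ℂ} (hzw : z * w = 1) (n : X) :
    defectComponent H z (n, w • n) = 0 := by
  refine ext_inner_left ℂ fun k => ?_
  rw [inner_defectComponent, inner_smul_right, inner_zero_right]
  linear_combination (-1 / 2 * inner ℂ (k : X) n) * hzw

/-- The symplectic form on `H*` in terms of the components in the defect subspaces. -/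
theorem inner_sub_inner_eq_defectComponent (hH : IsSymmetricRelation H) {f g : X × X}
    (hf : f ∈ H.adjoint) (hg : g ∈ H.adjoint) :
    inner ℂ f.2 g.1 - inner ℂ f.1 g.2 = -2 * Complex.I *
      (inner ℂ (defectComponent H Complex.I f) (defectComponent H Complex.I g) -
        inner ℂ (defectComponent H (-Complex.I) f) (defectComponent H (-Complex.I) g)) := by
  have hI : Complex.I * Complex.I = -1 := Complex.I_mul_I
  -- Only f has to be decomposed: pairings of n and m with the components of g are explicit by
  -- `inner_defectComponent`.
  obtain ⟨h, hh, n, hn, m, hm, rfl⟩ := exists_vonNeumann_decomposition H hH hf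
  have hW := inner_sub_inner_eq_zero_of_mem_closure H hh hg
  have hplus : defectComponent H Complex.I (h + (n, Complex.I • n) + (m, -Complex.I • m)) =
      ⟨n, hn⟩ := by
    rw [map_add, map_add, defectComponent_eq_zero_of_mem_closure H (by simp) hh,
      defectComponent_mk_smul_eq_zero H (w := -Complex.I) (by simp),
      defectComponent_mk_smul H hI ⟨n, hn⟩, zero_add, add_zero]
  have hminus : defectComponent H (-Complex.I) (h + (n, Complex.I • n) + (m, -Complex.I • m)) =
      ⟨m, hm⟩ := by
    rw [map_add, map_add, defectComponent_eq_zero_of_mem_closure H (by simp) hh,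
      defectComponent_mk_smul_eq_zero H (w := Complex.I) (by simp),
      defectComponent_mk_smul H (by simp) ⟨m, hm⟩, zero_add, zero_add]
  rw [hplus, hminus, inner_defectComponent, inner_defectComponent]
  simp only [Prod.fst_add, Prod.snd_add, inner_add_left, inner_smul_left, map_neg, Complex.conj_I]
  linear_combination hW - (inner ℂ n g.2 + inner ℂ m g.2) * hI

/-- The components in the defect subspaces, along a linear map onto `H*`. -/
noncomputable def defectComponents {D : Type*} [AddCommGroup D] [Module ℂ D]
    (L : D →ₗ[ℂ] X × X) :
    D →ₗ[ℂ] defectSubspace H Complex.I × defectSubspace H (-Complex.I) :=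
  ((defectComponent H Complex.I).prod (defectComponent H (-Complex.I))) ∘ₗ L

theorem defectComponents_surjective {D : Type*} [AddCommGroup D] [Module ℂ D]
    (L : D →ₗ[ℂ] X × X) (hL : LinearMap.range L = H.adjoint) :
    Function.Surjective (defectComponents H L) := by
  rintro ⟨n, m⟩
  have hf : ((n : X), Complex.I • (n : X)) + ((m : X), -Complex.I • (m : X)) ∈ H.adjoint :=
    H.adjoint.add_mem (mem_defectSubspace.mp n.2) (mem_defectSubspace.mp m.2)
  rw [← hL] at hf
  obtain ⟨d, hd⟩ := hf
  refine ⟨d, ?_⟩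
  rw [defectComponents, LinearMap.comp_apply, hd]
  ext1
  · change defectComponent H Complex.I _ = n
    rw [map_add, defectComponent_mk_smul H Complex.I_mul_I,
      defectComponent_mk_smul_eq_zero H (by simp), add_zero]
  · change defectComponent H (-Complex.I) _ = m
    rw [map_add, defectComponent_mk_smul_eq_zero H (w := Complex.I) (by simp),
      defectComponent_mk_smul H (by simp), zero_add]

/-! ### Kernels and defect subspaces -/

/-- For a coercive linear map `L` onto `H*`, the set of `d` with `(L d).2 = z (L d).1` has the same
Hilbert space dimension as the defect subspace at `z`, although it need not be closed. -/
theorem hilbertDim_eq_mk_of_defectSubspace {κ : Type u} {z : ℂ}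
    (c : HilbertBasis κ ℂ (defectSubspace H z)) {D : Submodule ℂ X} (L : D →ₗ[ℂ] X × X)
    (hL : LinearMap.range L = H.adjoint)
    (hcoercive : ∃ r : ℝ, 0 < r ∧ ∀ x : D, r * ‖(x : X)‖ ≤ ‖WithLp.toLp 2 (L x)‖)
    (K : Submodule ℂ X) (hK : ∀ x, x ∈ K ↔ ∃ d : D, (d : X) = x ∧ (L d).2 = z • (L d).1) :
    hilbertDim K = Cardinal.mk κ := by
  obtain ⟨r, hr, hbound⟩ := hcoercive
  have hinj : Function.Injective L := by
    refine (injective_iff_map_eq_zero _).mpr fun d hd => ?_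
    have h := hbound d
    rw [hd, WithLp.toLp_zero, norm_zero] at h
    have : ‖(d : X)‖ = 0 :=
      le_antisymm (nonpos_of_mul_nonpos_right h hr) (norm_nonneg _)
    simpa using this
  let Q : X →ₗ[ℂ] X × X := LinearMap.id.prod (z • LinearMap.id)
  let e := LinearEquiv.ofInjective L hinj
  -- J sends n to the unique d with L d = (n, z n). Coercivity bounds it by r⁻¹ times the norm of n
  -- ↦ (n, z n), which gives the continuous map T.
  let J : defectSubspace H z →ₗ[ℂ] D := e.symm.toLinearMap ∘ₗ
    (Q ∘ₗ (defectSubspace H z).subtype).codRestrict _ (fun n => hL.symm ▸ mem_defectSubspace.mp n.2)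
  have hJ : ∀ n, L (J n) = ((n : X), z • (n : X)) := fun n =>
    congrArg Subtype.val (e.apply_symm_apply _)
  have hJK : ∀ n, (J n : X) ∈ K := fun n => (hK _).mpr ⟨J n, rfl, by rw [hJ]⟩
  let Q' : X →L[ℂ] WithLp 2 (X × X) :=
    (WithLp.prodContinuousLinearEquiv 2 ℂ X X).symm.toContinuousLinearMap ∘L
      ((ContinuousLinearMap.id ℂ X).prod (z • ContinuousLinearMap.id ℂ X))
  let T : defectSubspace H z →L[ℂ] K.topologicalClosure :=
    ((D.subtype ∘ₗ J).codRestrict _ (fun n => K.le_topologicalClosure (hJK n))).mkContinuous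
      (r⁻¹ * ‖Q'‖) fun n => by
        have h := hbound (J n)
        rw [hJ] at h
        have h' : r * ‖(J n : X)‖ ≤ ‖Q'‖ * ‖n‖ := h.trans (Q'.le_opNorm (n : X))
        change ‖(J n : X)‖ ≤ _
        rw [mul_assoc, inv_mul_eq_div, le_div_iff₀ hr, mul_comm]
        exact h'
  have hT : ∀ n, (T n : X) = J n := fun n => rfl
  -- This basis is indexed by the very set whose cardinality defines `hilbertDim K`.
  obtain ⟨b, -⟩ := (exists_hilbertBasis ℂ K.topologicalClosure).choose_spec
  refine (c.mk_eq_of_injective_of_denseRange b T ?_ ?_).symm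
  · intro n m hnm
    have hval : (T n : X) = T m := by rw [hnm]
    have h : J n = J m := Subtype.ext hval
    have h' := congrArg L h
    rw [hJ, hJ] at h'
    exact Subtype.ext (congrArg Prod.fst h')
  · have hdense := (denseRange_inclusion_iff (K.le_topologicalClosure :
      (K : Set X) ⊆ (K.topologicalClosure : Set X))).mpr (fun x hx => hx)
    -- All of K lies in the range of T: a point d of K is the image of (L d).1.
    refine hdense.mono ?_
    rintro _ ⟨⟨x, hx⟩, rfl⟩
    obtain ⟨d, rfl, hd⟩ := (hK x).mp hx
    have hLd : L d ∈ H.adjoint := hL ▸ LinearMap.mem_range_self L d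
    have hmem : (L d).1 ∈ defectSubspace H z := by
      rw [mem_defectSubspace, ← hd]
      exact hLd
    refine ⟨⟨(L d).1, hmem⟩, Subtype.ext ?_⟩
    rw [hT]
    change (J _ : X) = (d : X)
    congr 1
    apply hinj
    rw [hJ]
    exact Prod.ext rfl hd.symm
end

theorem mem_kernelOp_sub_smul {X : Type u} [NormedAddCommGroup X] [InnerProductSpace ℂ X]
    (P S : X →ₗ.[ℂ] X) (z : ℂ) (x : X) :
    x ∈ kernelOp (S - z • P) ↔ ∃ d : (columnOp P S).domain, (d : X) = x ∧
      ((columnOp P S).toFun d).2 = z • ((columnOp P S).toFun d).1 := by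
  constructor
  · rintro ⟨d, hd, rfl⟩
    exact ⟨⟨d, d.2.2, d.2.1⟩, rfl, sub_eq_zero.mp hd⟩
  · rintro ⟨d, rfl, hd⟩
    exact ⟨⟨d, d.2.2, d.2.1⟩, sub_eq_zero.mpr hd, rfl⟩

theorem mem_kernelOp_add_smul {X : Type u} [NormedAddCommGroup X] [InnerProductSpace ℂ X]
    (P S : X →ₗ.[ℂ] X) (z : ℂ) (x : X) :
    x ∈ kernelOp (S + z • P) ↔ ∃ d : (columnOp P S).domain, (d : X) = x ∧
      ((columnOp P S).toFun d).2 = -z • ((columnOp P S).toFun d).1 := by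
  simp only [neg_smul]
  constructor
  · rintro ⟨d, hd, rfl⟩
    exact ⟨⟨d, d.2.2, d.2.1⟩, rfl, eq_neg_of_add_eq_zero_left hd⟩
  · rintro ⟨d, rfl, hd⟩
    exact ⟨⟨d, d.2.2, d.2.1⟩, add_eq_zero_iff_eq_neg.mpr hd, rfl⟩

/-! ### Boundary triplets and the Cayley transform -/

section
variable {X : Type u} [NormedAddCommGroup X] [InnerProductSpace ℂ X] {P S : X →ₗ.[ℂ] X}
  {G : Type u} [NormedAddCommGroup G] [InnerProductSpace ℂ G] [CompleteSpace G]

/-- The Cayley transform of the boundary maps, which diagonalizes the boundary form. -/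
noncomputable def RangeBoundaryTriplet.cayley (τ : RangeBoundaryTriplet P S G) :
    (columnOp P S).domain →ₗ[ℂ] G × G :=
  ((1 / 2 : ℂ) • (τ.Γ₀ - Complex.I • τ.Γ₁)).prod ((1 / 2 : ℂ) • (τ.Γ₀ + Complex.I • τ.Γ₁))

theorem RangeBoundaryTriplet.cayley_surjective (τ : RangeBoundaryTriplet P S G) :
    Function.Surjective τ.cayley := by
  rintro ⟨u, v⟩
  -- These values solve u = (Γ₀ - iΓ₁)/2, v = (Γ₀ + iΓ₁)/2.
  obtain ⟨d, hd⟩ := τ.surjective (u + v, Complex.I • (u - v))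
  have h₀ : τ.Γ₀ d = u + v := congrArg Prod.fst hd
  have h₁ : τ.Γ₁ d = Complex.I • (u - v) := congrArg Prod.snd hd
  have hI : Complex.I * Complex.I = -1 := Complex.I_mul_I
  refine ⟨d, ?_⟩
  ext1
  · change (1 / 2 : ℂ) • (τ.Γ₀ d - Complex.I • τ.Γ₁ d) = u
    rw [h₀, h₁, smul_smul, hI]
    module
  · change (1 / 2 : ℂ) • (τ.Γ₀ d + Complex.I • τ.Γ₁ d) = v
    rw [h₀, h₁, smul_smul, hI]
    module

/-- Substitute Γ₀ = u + v and Γ₁ = i(u - v) in the Green identity; the cross terms cancel. The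
factor -2i agrees with the one for the defect components, so the two diagonal forms can be compared
directly. -/
theorem RangeBoundaryTriplet.green_cayley (τ : RangeBoundaryTriplet P S G)
    (x y : (columnOp P S).domain) :
    inner ℂ (columnOp P S x).2 (columnOp P S y).1 - inner ℂ (columnOp P S x).1 (columnOp P S y).2 =
      -2 * Complex.I * (inner ℂ (τ.cayley x).1 (τ.cayley y).1 -
        inner ℂ (τ.cayley x).2 (τ.cayley y).2) := by
  have hI : Complex.I * Complex.I = -1 := Complex.I_mul_I
  have hfst : ∀ d, (τ.cayley d).1 = (1 / 2 : ℂ) • (τ.Γ₀ d - Complex.I • τ.Γ₁ d) := fun _ => rfl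
  have hsnd : ∀ d, (τ.cayley d).2 = (1 / 2 : ℂ) • (τ.Γ₀ d + Complex.I • τ.Γ₁ d) := fun _ => rfl
  rw [τ.green]
  simp only [hfst, hsnd, inner_smul_left, inner_smul_right, inner_add_left, inner_add_right,
    inner_sub_left, inner_sub_right, map_div₀, map_one, Complex.conj_ofNat, Complex.conj_I]
  linear_combination (inner ℂ (τ.Γ₀ x) (τ.Γ₁ y) - inner ℂ (τ.Γ₁ x) (τ.Γ₀ y)) * -hI
end

/-- A boundary triplet obtained from a linear map which diagonalizes the boundary form. -/
noncomputable def RangeBoundaryTriplet.ofCayley {X : Type u} [NormedAddCommGroup X]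
    [InnerProductSpace ℂ X] {P S : X →ₗ.[ℂ] X} {G : Type u} [NormedAddCommGroup G]
    [InnerProductSpace ℂ G] [CompleteSpace G] (Ψ : (columnOp P S).domain →ₗ[ℂ] G × G)
    (hΨ : Function.Surjective Ψ)
    (hgreen : ∀ x y : (columnOp P S).domain,
      inner ℂ (columnOp P S x).2 (columnOp P S y).1 -
          inner ℂ (columnOp P S x).1 (columnOp P S y).2 =
        -2 * Complex.I * (inner ℂ (Ψ x).1 (Ψ y).1 - inner ℂ (Ψ x).2 (Ψ y).2)) :
    RangeBoundaryTriplet P S G where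
  Γ₀ := (LinearMap.fst ℂ G G + LinearMap.snd ℂ G G) ∘ₗ Ψ
  Γ₁ := Complex.I • (LinearMap.fst ℂ G G - LinearMap.snd ℂ G G) ∘ₗ Ψ
  surjective := by
    rintro ⟨a, b⟩
    obtain ⟨d, hd⟩ := hΨ ((1 / 2 : ℂ) • (a - Complex.I • b), (1 / 2 : ℂ) • (a + Complex.I • b))
    have hI : Complex.I * Complex.I = -1 := Complex.I_mul_I
    refine ⟨d, ?_⟩
    ext1
    · change (Ψ d).1 + (Ψ d).2 = a
      rw [hd]
      module
    · change Complex.I • ((Ψ d).1 - (Ψ d).2) = b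
      rw [hd]
      match_scalars <;> first | ring1 | linear_combination -hI
  green x y := by
    rw [hgreen]
    simp only [LinearMap.comp_apply, LinearMap.smul_apply, LinearMap.add_apply,
      LinearMap.sub_apply, LinearMap.fst_apply, LinearMap.snd_apply, inner_smul_left,
      inner_smul_right, inner_add_left, inner_add_right, inner_sub_left, inner_sub_right,
      Complex.conj_I]
    ring

/-! ### Existence criterion for boundary triplets -/

theorem theorem2p12 {X : Type u} [NormedAddCommGroup X] [InnerProductSpace ℂ X] [CompleteSpace X]
    (P₀ S₀ : X →ₗ.[ℂ] X)
    (hP₀ : Dense (P₀.domain : Set X)) (hS₀ : Dense (S₀.domain : Set X))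
    (hcoercive : ColumnCoercive P₀† S₀†)
    (hadjoint : (kernelRelation P₀ S₀).adjoint = rangeRelation P₀† S₀†)
    (hsymm : IsSymmetricRelation (kernelRelation P₀ S₀)) :
    (∃ (G : Type u) (_ : NormedAddCommGroup G) (_ : InnerProductSpace ℂ G) (_ : CompleteSpace G),
        Nonempty (RangeBoundaryTriplet P₀† S₀† G)) ↔
      hilbertDim (kernelOp (S₀† - Complex.I • P₀†)) =
        hilbertDim (kernelOp (S₀† + Complex.I • P₀†)) := by
  set H := kernelRelation P₀ S₀
  let L := (columnOp P₀† S₀†).toFun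
  have hL : LinearMap.range L = H.adjoint := hadjoint.symm
  obtain ⟨_, b, -⟩ := exists_hilbertBasis ℂ (defectSubspace H Complex.I)
  obtain ⟨_, c, -⟩ := exists_hilbertBasis ℂ (defectSubspace H (-Complex.I))
  rw [hilbertDim_eq_mk_of_defectSubspace H b L hL hcoercive _ (mem_kernelOp_sub_smul _ _ _),
    hilbertDim_eq_mk_of_defectSubspace H c L hL hcoercive _ (mem_kernelOp_add_smul _ _ _)]
  have hΦ := defectComponents_surjective H L hL
  have hform : ∀ x y : (columnOp P₀† S₀†).domain,
      inner ℂ (L x).2 (L y).1 - inner ℂ (L x).1 (L y).2 =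
        -2 * Complex.I * (inner ℂ (defectComponents H L x).1 (defectComponents H L y).1 -
          inner ℂ (defectComponents H L x).2 (defectComponents H L y).2) := fun x y =>
    inner_sub_inner_eq_defectComponent H hsymm (hL ▸ LinearMap.mem_range_self L x)
      (hL ▸ LinearMap.mem_range_self L y)
  constructor
  · rintro ⟨G, _, _, _, ⟨τ⟩⟩
    obtain ⟨_, g, -⟩ := exists_hilbertBasis ℂ G
    have heq : ∀ x y, inner ℂ (defectComponents H L x).1 (defectComponents H L y).1 -
        inner ℂ (defectComponents H L x).2 (defectComponents H L y).2 =
        inner ℂ (τ.cayley x).1 (τ.cayley y).1 - inner ℂ (τ.cayley x).2 (τ.cayley y).2 := fun x y =>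
      mul_left_cancel₀ (by simp) ((hform x y).symm.trans (τ.green_cayley x y))
    -- The first factors give dim N(i) = dim G. Exchanging the factors on both sides only negates
    -- the form, which gives dim N(-i) = dim G.
    exact (b.mk_eq_of_indefinite_form_eq g _ _ hΦ τ.cayley_surjective heq).trans
      (c.mk_eq_of_indefinite_form_eq g
        ((LinearEquiv.prodComm ℂ _ _).toLinearMap ∘ₗ defectComponents H L)
        ((LinearEquiv.prodComm ℂ _ _).toLinearMap ∘ₗ τ.cayley)
        ((LinearEquiv.prodComm ℂ _ _).surjective.comp hΦ)
        ((LinearEquiv.prodComm ℂ _ _).surjective.comp τ.cayley_surjective)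
        (fun x y => by simpa using congrArg Neg.neg (heq x y))).symm
  · intro hdim
    obtain ⟨U⟩ := b.nonempty_linearIsometryEquiv c hdim
    refine ⟨defectSubspace H (-Complex.I), inferInstance, inferInstance, inferInstance,
      ⟨RangeBoundaryTriplet.ofCayley
        ((U.toLinearEquiv.prodCongr (LinearEquiv.refl ℂ _)).toLinearMap ∘ₗ defectComponents H L)
        ((U.toLinearEquiv.prodCongr (LinearEquiv.refl ℂ _)).surjective.comp hΦ) fun x y => ?_⟩⟩
    -- The isometry `U` preserves the first inner product and the second is untouched.
    refine (hform x y).trans ?_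
    congr 2
    exact (U.inner_map_map _ _).symm
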